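/- Let $d,N\ge 1$ and let $(X_1,Y_1),\dots,(X_N,Y_N)$ be i.i.d. observations from a probability law $P$ on $\mathbb{R}^d\times\mathcal{Y}$. Let $C$ be a fixed prediction-set map, assigning to each $x\in\mathbb{R}^d$ a set $C(x)\subseteq\mathcal{Y}$ (not depending on these $N$ observations), with $\{(x,y): y\in C(x)\}$ measurable. Let $\Pi$ be a non-empty set of quadratic functions $\pi(x)=x^{\top}Wx+v^{\top}x$ with $W\in\mathbb{R}^{d\times d}$ and $v\in\mathbb{R}^d$, and let $\alpha\in(0,1)$ and $\delta\in(0,1]$. Let $\mathbb{P}_n$ denote the empirical distribution of the $N$ observations and put $$\mathrm{WSC}^+_n(C,\pi)=\inf_{a<b}\bigl\{\mathbb{P}_n(Y\in C(X)\mid a\le\pi(X)\le b)\ :\ \mathbb{P}_n(a\le\pi(X)\le b)\ge\delta\bigr\},\qquad \mathrm{WSC}^+_n=\inf_{\pi\in\Pi}\mathrm{WSC}^+_n(C,\pi).$$ Suppose that $C$ has conditional coverage at level $1-\alpha$ on slabs: $P(Y\in C(X)\mid a\le\pi(X)\le b)\ge 1-\alpha$ for all $\pi\in\Pi$ and all $a<b$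 with $P(a\le\pi(X)\le b)>0$. Then for every $\tau>0$, with probability at least $1-e^{-\tau}$, $$\mathrm{WSC}^+_n\ \ge\ 1-\alpha-K\sqrt{\frac{d^2\log N+\tau}{\delta N}},$$ where $K>0$ is a universal constant (independent of $d,N,P,\mathcal{Y},C,\Pi,\alpha,\delta,\tau$). -/

import Mathlib

open MeasureTheory ProbabilityTheory
open scoped Matrix

universe u

noncomputable section

/-- The quadratic function `x ↦ xᵀ W x + vᵀ x` on `ℝ^d`. -/
def quadraticFn {d : ℕ} (W : Matrix (Fin d) (Fin d) ℝ) (v : Fin d → ℝ) (x : Fin d → ℝ) : ℝ :=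
  x ⬝ᵥ (W *ᵥ x) + v ⬝ᵥ x

/-- The event `a ≤ π(X) ≤ b`, as a set of pairs `(x, y)`. -/
def slabEvent {𝒳 : Type*} {𝒴 : Type*} (π : 𝒳 → ℝ) (a b : ℝ) : Set (𝒳 × 𝒴) :=
  {z | a ≤ π z.1 ∧ π z.1 ≤ b}

/-- The event `Y ∈ C(X)`, as a set of pairs `(x, y)`. -/
def coverEvent {𝒳 : Type*} {𝒴 : Type*} (C : 𝒳 → Set 𝒴) : Set (𝒳 × 𝒴) :=
  {z | z.2 ∈ C z.1}

/-- The empirical probability `ℙₙ(A)`: the fraction of the observations `s 0, …, s (N - 1)`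
that lie in `A`. -/
def empProb {N : ℕ} {Z : Type*} (s : Fin N → Z) (A : Set Z) : ℝ :=
  ((Set.ncard {i : Fin N | s i ∈ A} : ℕ) : ℝ) / (N : ℝ)

/-- The empirical conditional probability `ℙₙ(A | B) = ℙₙ(A ∩ B) / ℙₙ(B)`
(only used when `ℙₙ(B) > 0`). -/
def empCondProb {N : ℕ} {Z : Type*} (s : Fin N → Z) (A B : Set Z) : ℝ :=
  empProb s (A ∩ B) / empProb s B

/-- `WSC⁺ₙ(C, π)`: the infimum over `a < b` of `ℙₙ(Y ∈ C(X) | a ≤ π(X) ≤ b)`, subject to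
`ℙₙ(a ≤ π(X) ≤ b) ≥ δ`. -/
def wscPlus {N : ℕ} {𝒳 : Type*} {𝒴 : Type*} (C : 𝒳 → Set 𝒴) (δ : ℝ) (s : Fin N → 𝒳 × 𝒴)
    (π : 𝒳 → ℝ) : ℝ :=
  sInf {r : ℝ | ∃ a b : ℝ, a < b ∧ δ ≤ empProb s (slabEvent π a b) ∧
    r = empCondProb s (coverEvent C) (slabEvent π a b)}

/-- `WSC⁺ₙ = inf_{π ∈ Π} WSC⁺ₙ(C, π)`, where the quadratic functions `π` are given by a set `Θ` of
parameters `(W, v)`. -/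
def wscPlusInf {N d : ℕ} {𝒴 : Type*} (C : (Fin d → ℝ) → Set 𝒴) (δ : ℝ)
    (s : Fin N → (Fin d → ℝ) × 𝒴) (Θ : Set (Matrix (Fin d) (Fin d) ℝ × (Fin d → ℝ))) : ℝ :=
  ⨅ θ : Θ, wscPlus C δ s (quadraticFn θ.1.1 θ.1.2)

/-- Under the law `P` of `(X, Y)`, the prediction set `C` has coverage at least `1 - α` conditionally
on every slab `a ≤ π(X) ≤ b` of positive probability, `π` a quadratic function with parameters
in `Θ`. -/
def HasSlabCoverage {d : ℕ} {𝒴 : Type*} [MeasurableSpace 𝒴] (P : Measure ((Fin d → ℝ) × 𝒴))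
    (C : (Fin d → ℝ) → Set 𝒴) (α : ℝ)
    (Θ : Set (Matrix (Fin d) (Fin d) ℝ × (Fin d → ℝ))) : Prop :=
  ∀ θ ∈ Θ, ∀ a b : ℝ, a < b → P (slabEvent (quadraticFn θ.1 θ.2) a b) ≠ 0 →
    ENNReal.ofReal (1 - α) ≤ P[coverEvent C | slabEvent (quadraticFn θ.1 θ.2) a b]

end

/-! Write `D` for miscoverage, `B` for a slab. Coverage says that `c (1_D - α) 1_B` has mean at most
0. A uniform Hoeffding bound on its empirical mean, divided by the slab's empirical mass, would lose
a factor `1/δ`; the claimed rate `1/√δ` needs self-normalization. So a penalty `4c² 1_B` is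
subtracted: its total is proportional to the number of points in `B` and pays for the fluctuation on
that slab. The penalized exponential sum is controlled uniformly by symmetrization. By Jensen, an
independent ghost sample contributes a factor of mean at least 1
(`one_le_lintegral_exp_neg_slabWeight`). Randomly swapping each point with its ghost gives an
average weight at most 1 per pair (`exp_slabWeight_swap_le`). On the `2N` points only the slab's
trace matters, so the supremum costs the number `G` of traces, polynomial in `N` with exponent of
order `d²` by Dudley and Sauer–Shelah (`ncard_slab_traces_le`). Markov's inequality and `c = √((d²
log N + τ)/(δN))` finish the case `N ≥ 2`. For `N = 1` the logarithm vanishes and marginal coverage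
is used instead. -/

/-! ### VC theory: counting the traces of quadratic slabs. -/

theorem sum_range_choose_le_succ_pow (n m : ℕ) :
    ∑ k ∈ Finset.range (m + 1), n.choose k ≤ (n + 1) ^ m := by
  induction m with
  | zero => simp
  | succ m ih =>
    rw [Finset.sum_range_succ, pow_succ]
    have h1 : n.choose (m + 1) ≤ n ^ (m + 1) := Nat.choose_le_pow n (m + 1)
    have h2 : n ^ m ≤ (n + 1) ^ m := Nat.pow_le_pow_left (Nat.le_succ n) m
    rw [pow_succ] at h1
    nlinarith

/-- Sauer–Shelah in polynomial form. -/
theorem card_le_succ_pow_of_shatters {κ : Type*} [Fintype κ] [DecidableEq κ]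
    (𝒜 : Finset (Finset κ)) (m : ℕ) (h : ∀ S, 𝒜.Shatters S → S.card ≤ m) :
    𝒜.card ≤ (Fintype.card κ + 1) ^ m := by
  refine (Finset.card_le_card_shatterer 𝒜).trans (Finset.card_shatterer_le_sum_vcDim.trans ?_)
  refine le_trans ?_ (sum_range_choose_le_succ_pow (Fintype.card κ) m)
  refine Finset.sum_le_sum_of_subset fun k hk => ?_
  have hv : 𝒜.vcDim ≤ m := Finset.sup_le fun S hS => h S (Finset.mem_shatterer.1 hS)
  have := Finset.mem_Iic.1 hk
  exact Finset.mem_range.2 (by omega)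

open Classical in
/-- The nonnegativity sets on `κ` of the functions in the range of `L`. -/
noncomputable def nonnegTraces {κ E : Type*} [Fintype κ] [AddCommGroup E] [Module ℝ E]
    (L : E →ₗ[ℝ] (κ → ℝ)) : Finset (Finset κ) :=
  Finset.univ.filter fun T => ∃ e, ∀ k, k ∈ T ↔ 0 ≤ L e k

theorem mem_nonnegTraces {κ E : Type*} [Fintype κ] [AddCommGroup E] [Module ℝ E]
    {L : E →ₗ[ℝ] (κ → ℝ)} {T : Finset κ} :
    T ∈ nonnegTraces L ↔ ∃ e, ∀ k, k ∈ T ↔ 0 ≤ L e k := by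
  simp [nonnegTraces]

/-- Dudley's bound on the VC dimension of nonnegativity sets of a vector space of functions. -/
theorem card_le_finrank_of_shatters_nonnegTraces {κ E : Type*} [Fintype κ] [DecidableEq κ]
    [AddCommGroup E] [Module ℝ E] [Module.Finite ℝ E] (L : E →ₗ[ℝ] (κ → ℝ)) (S : Finset κ)
    (hS : (nonnegTraces L).Shatters S) : S.card ≤ Module.finrank ℝ E := by
  by_contra! hlt
  let R : E →ₗ[ℝ] (S → ℝ) := (LinearMap.funLeft ℝ ℝ (Subtype.val : S → κ)).comp L
  have hR : LinearMap.range R < ⊤ := by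
    rw [lt_top_iff_ne_top]
    intro h
    have h1 := LinearMap.finrank_range_le R
    rw [h, finrank_top, Module.finrank_fintype_fun_eq_card, Fintype.card_coe] at h1
    omega
  obtain ⟨f, hf0, hf⟩ := Submodule.exists_le_ker_of_lt_top _ hR
  -- A nonzero functional vanishes on the restrictions to `S`. Its sign is chosen to make some
  -- coefficient strictly negative: matching nonnegativity sets then gives a strictly positive
  -- product there, whereas a zero value against a positive coefficient would not.
  have hneg : ∃ f : (S → ℝ) →ₗ[ℝ] ℝ, (∃ s : S, f (Pi.single s 1) < 0) ∧
      LinearMap.range R ≤ LinearMap.ker f := by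
    have : ∃ s : S, f (Pi.single s 1) ≠ 0 := by
      by_contra! h
      exact hf0 (LinearMap.pi_ext' fun s => LinearMap.ext_ring (by simpa using h s))
    obtain ⟨s, hs⟩ := this
    rcases lt_or_gt_of_ne hs with h | h
    · exact ⟨f, ⟨s, h⟩, hf⟩
    · refine ⟨-f, ⟨s, by simpa using h⟩, fun x hx => ?_⟩
      have := hf hx
      simp only [LinearMap.mem_ker] at this ⊢
      simp [this]
  obtain ⟨f, ⟨s₀, hs₀⟩, hf⟩ := hneg
  have hsub : S.filter (fun k => ∃ h : k ∈ S, 0 ≤ f (Pi.single ⟨k, h⟩ 1)) ⊆ S :=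
    Finset.filter_subset _ _
  obtain ⟨T, hT, hST⟩ := hS hsub
  obtain ⟨e, he⟩ := mem_nonnegTraces.1 hT
  have key : ∀ s : S, 0 ≤ L e s ↔ 0 ≤ f (Pi.single s 1) := by
    intro s
    rw [← he s]
    have h := Finset.ext_iff.1 hST s
    simp only [Finset.mem_inter, Finset.mem_filter, s.2, true_and, exists_true_left] at h
    exact h
  have hz : f (R e) = 0 := hf (LinearMap.mem_range_self R e)
  rw [LinearMap.pi_apply_eq_sum_univ] at hz
  have hpos : 0 < ∑ s : S, R e s • f (fun j => if s = j then 1 else 0) := by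
    have hsingle : ∀ s : S, (fun j => if s = j then (1 : ℝ) else 0) = Pi.single s 1 := by
      intro s
      ext j
      simp [Pi.single_apply, eq_comm]
    have hRe : ∀ s : S, R e s = L e s := fun s => rfl
    simp only [hsingle, hRe, smul_eq_mul]
    refine Finset.sum_pos' (fun s _ => ?_) ⟨s₀, Finset.mem_univ _, ?_⟩
    · by_cases h : 0 ≤ L e s
      · exact mul_nonneg h ((key s).1 h)
      · have h2 := mt (key s).2 h
        exact mul_nonneg_of_nonpos_of_nonpos (not_le.1 h).le (not_le.1 h2).le
    · exact mul_pos_of_neg_of_neg (not_le.1 (mt (key s₀).1 (not_le.2 hs₀))) hs₀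
  exact hpos.ne' hz

theorem card_nonnegTraces_le {κ E : Type*} [Fintype κ]
    [AddCommGroup E] [Module ℝ E] [Module.Finite ℝ E] (L : E →ₗ[ℝ] (κ → ℝ)) :
    (nonnegTraces L).card ≤ (Fintype.card κ + 1) ^ Module.finrank ℝ E := by
  classical
  exact card_le_succ_pow_of_shatters _ _ fun S hS =>
    card_le_finrank_of_shatters_nonnegTraces L S hS

/-- Evaluation of `x ↦ xᵀ W x + vᵀ x + c` at the points `x k`, as a linear map of `(W, v, c)`. -/
def quadraticEval {κ : Type*} {d : ℕ} (x : κ → Fin d → ℝ) :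
    (Matrix (Fin d) (Fin d) ℝ × (Fin d → ℝ)) × ℝ →ₗ[ℝ] (κ → ℝ) where
  toFun e k := quadraticFn e.1.1 e.1.2 (x k) + e.2
  map_add' e e' := by
    ext k
    simp only [quadraticFn, Prod.fst_add, Prod.snd_add, Matrix.add_mulVec, dotProduct_add,
      add_dotProduct, Pi.add_apply]
    ring
  map_smul' r e := by
    ext k
    simp only [quadraticFn, Prod.smul_fst, Prod.smul_snd, Matrix.smul_mulVec, dotProduct_smul,
      smul_dotProduct, Pi.smul_apply, smul_eq_mul, RingHom.id_apply]
    ring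

/-- A slab is the intersection of two nonnegativity sets, of `π - a` and of `b - π`, both from a
space of dimension `d² + d + 1`; hence the doubled exponent. -/
theorem ncard_slab_traces_le {κ ι : Type*} [Fintype κ] {d : ℕ} (x : κ → Fin d → ℝ)
    (θ : ι → Matrix (Fin d) (Fin d) ℝ × (Fin d → ℝ)) (a b : ι → ℝ) :
    (Set.range fun i => {k | a i ≤ quadraticFn (θ i).1 (θ i).2 (x k) ∧
      quadraticFn (θ i).1 (θ i).2 (x k) ≤ b i}).ncard
      ≤ (Fintype.card κ + 1) ^ (2 * (d ^ 2 + d + 1)) := by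
  classical
  set 𝒜 := nonnegTraces (quadraticEval x) with h𝒜
  have hcard : 𝒜.card ≤ (Fintype.card κ + 1) ^ (d ^ 2 + d + 1) := by
    have h := card_nonnegTraces_le (quadraticEval x)
    have hr : Module.finrank ℝ ((Matrix (Fin d) (Fin d) ℝ × (Fin d → ℝ)) × ℝ) = d ^ 2 + d + 1 := by
      simp [Module.finrank_prod, Module.finrank_matrix, sq]
    rwa [hr] at h
  have hmem : ∀ (e : (Matrix (Fin d) (Fin d) ℝ × (Fin d → ℝ)) × ℝ),
      (Finset.univ.filter fun k => 0 ≤ quadraticEval x e k) ∈ 𝒜 := fun e =>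
    mem_nonnegTraces.2 ⟨e, by simp⟩
  have hsub : (Set.range fun i => {k | a i ≤ quadraticFn (θ i).1 (θ i).2 (x k) ∧
      quadraticFn (θ i).1 (θ i).2 (x k) ≤ b i}) ⊆
      (((𝒜 ×ˢ 𝒜).image fun p => ((p.1 ∩ p.2 : Finset κ) : Set κ) : Finset (Set κ)) :
        Set (Set κ)) := by
    rintro _ ⟨i, rfl⟩
    rw [Finset.coe_image]
    refine ⟨(_, _), Finset.mem_coe.2 (Finset.mem_product.2
      ⟨hmem (θ i, -a i), hmem (-(θ i, -b i))⟩), ?_⟩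
    ext k
    simp only [map_neg, Pi.neg_apply]
    simp [quadraticEval]
  calc _ ≤ _ := Set.ncard_le_ncard hsub (Finset.finite_toSet _)
    _ ≤ (𝒜 ×ˢ 𝒜).card := by rw [Set.ncard_coe_finset]; exact Finset.card_image_le
    _ ≤ _ := by
      rw [Finset.card_product, two_mul, pow_add]
      exact Nat.mul_le_mul hcard hcard

/-! ### Symmetrization with self-normalized exponential weights. -/

section Symmetrization

variable {Z : Type*}

open Classical in
/-- The weight `c • (1_D - α) • 1_B` of a point, minus the self-normalizing penalty `q • 1_B`. -/
noncomputable def slabWeight (D B : Set Z) (α c q : ℝ) (z : Z) : ℝ :=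
  if z ∈ B then c * ((if z ∈ D then 1 else 0) - α) - q else 0

theorem abs_slabWeight_le {D B : Set Z} {α c q : ℝ} (z : Z) :
    |slabWeight D B α c q z| ≤ |c| * (1 + |α|) + |q| := by
  have h0 : 0 ≤ |c| * (1 + |α|) + |q| := by positivity
  unfold slabWeight
  split_ifs with hB hD
  · refine (abs_sub _ _).trans ?_
    rw [abs_mul]
    gcongr
    exact (abs_sub _ _).trans (by simp)
  · refine (abs_sub _ _).trans ?_
    rw [abs_mul]
    gcongr
    exact (abs_sub _ _).trans (by simp)
  · simpa using h0

theorem measurable_slabWeight [MeasurableSpace Z] {D B : Set Z} (hD : MeasurableSet D)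
    (hB : MeasurableSet B) (α c q : ℝ) : Measurable (slabWeight D B α c q) := by
  classical
  unfold slabWeight
  exact Measurable.ite hB
    (((measurable_const.ite hD measurable_const).sub_const _ |>.const_mul _).sub_const _)
    measurable_const

theorem integrable_slabWeight [MeasurableSpace Z] {P : Measure Z} [IsProbabilityMeasure P]
    {D B : Set Z} (hD : MeasurableSet D) (hB : MeasurableSet B) (α c q : ℝ) :
    Integrable (slabWeight D B α c q) P :=
  Integrable.of_bound (measurable_slabWeight hD hB α c q).aestronglyMeasurable
    (|c| * (1 + |α|) + |q|) (Filter.Eventually.of_forall fun z => abs_slabWeight_le z)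

theorem integral_slabWeight [MeasurableSpace Z] {P : Measure Z} [IsProbabilityMeasure P]
    {D B : Set Z} (hD : MeasurableSet D) (hB : MeasurableSet B) (α c : ℝ) :
    ∫ z, slabWeight D B α c 0 z ∂P = c * (P.real (D ∩ B) - α * P.real B) := by
  have h : ∀ z, slabWeight D B α c 0 z =
      c * ((D ∩ B).indicator 1 z - α * B.indicator 1 z) := by
    intro z
    by_cases hzB : z ∈ B <;> by_cases hzD : z ∈ D <;> simp [slabWeight, hzB, hzD]
  have i1 : Integrable ((D ∩ B).indicator (1 : Z → ℝ)) P :=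
    (integrable_const (1 : ℝ)).indicator (hD.inter hB)
  have i2 : Integrable (B.indicator (1 : Z → ℝ)) P := (integrable_const (1 : ℝ)).indicator hB
  simp_rw [h]
  rw [integral_const_mul, integral_sub i1 (i2.const_mul α), integral_const_mul,
    integral_indicator_one (hD.inter hB), integral_indicator_one hB]

/-- The two orderings of a pair of points have average weight at most one. -/
theorem exp_slabWeight_swap_le {D B : Set Z} {α c : ℝ} (hα0 : 0 ≤ α) (hα1 : α ≤ 1) (hc0 : 0 ≤ c)
    (hc1 : c ≤ 1 / 2) (z z' : Z) :
    Real.exp (slabWeight D B α c (4 * c ^ 2) z - slabWeight D B α c 0 z') +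
      Real.exp (slabWeight D B α c (4 * c ^ 2) z' - slabWeight D B α c 0 z) ≤ 2 := by
  have key : ∀ u m : ℝ, u ^ 2 / 2 ≤ m → Real.exp (u - m) + Real.exp (-u - m) ≤ 2 := by
    intro u m h
    have h1 : Real.exp (u - m) + Real.exp (-u - m) = 2 * (Real.cosh u * Real.exp (-m)) := by
      rw [Real.cosh_eq, sub_eq_add_neg, sub_eq_add_neg, Real.exp_add, Real.exp_add]
      ring
    have h2 : Real.cosh u * Real.exp (-m) ≤ 1 := by
      calc _ ≤ Real.exp (u ^ 2 / 2) * Real.exp (-m) := by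
            gcongr
            exact Real.cosh_le_exp_half_sq u
        _ = Real.exp (u ^ 2 / 2 - m) := by rw [← Real.exp_add]; ring_nf
        _ ≤ 1 := Real.exp_le_one_iff.2 (by linarith)
    linarith
  -- Only one point lies in `B`, so only one ordering carries the penalty. Recentring at `u = c (y -
  -- 2c)` splits it as `2c²` on each; `c ≤ 1/2` gives `|y - 2c| ≤ 2`, so `u²/2 ≤ 2c²`. This case
  -- dictates the constant 4.
  have single : ∀ y : ℝ, |y| ≤ 1 →
      Real.exp (c * y - 4 * c ^ 2) + Real.exp (-(c * y)) ≤ 2 := by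
    intro y hy
    obtain ⟨hy1, hy2⟩ := abs_le.1 hy
    have h := key (c * (y - 2 * c)) (2 * c ^ 2) (by
      have : (y - 2 * c) ^ 2 ≤ 4 := by nlinarith
      have := mul_le_mul_of_nonneg_left this (sq_nonneg c)
      nlinarith)
    convert! h using 3 <;> ring
  have pair : ∀ y y' : ℝ, |y - y'| ≤ 1 →
      Real.exp (c * y - 4 * c ^ 2 - c * y') + Real.exp (c * y' - 4 * c ^ 2 - c * y) ≤ 2 := by
    intro y y' hy
    have h := key (c * (y - y')) (4 * c ^ 2) (by
      have : (y - y') ^ 2 ≤ 1 := (sq_le_one_iff_abs_le_one _).2 hy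
      have := mul_le_mul_of_nonneg_left this (sq_nonneg c)
      nlinarith [sq_nonneg c])
    convert! h using 3 <;> ring
  have bd : ∀ z : Z, |(open Classical in if z ∈ D then (1 : ℝ) else 0) - α| ≤ 1 := by
    intro z
    split_ifs <;> rw [abs_le] <;> constructor <;> linarith
  have bd2 : ∀ z z' : Z, |((open Classical in if z ∈ D then (1 : ℝ) else 0) - α) -
      ((open Classical in if z' ∈ D then (1 : ℝ) else 0) - α)| ≤ 1 := by
    intro z z'
    split_ifs <;> rw [abs_le] <;> constructor <;> linarith
  by_cases hz : z ∈ B <;> by_cases hz' : z' ∈ B <;>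
    simp only [slabWeight, hz, hz', if_true, if_false, sub_zero, zero_sub]
  · exact pair _ _ (bd2 z z')
  · exact single _ (bd z)
  · rw [add_comm]
    exact single _ (bd z')
  · norm_num

/-- Exchange of the two members of the pairs selected by `σ`. -/
def swapPairs {N : ℕ} (σ : Fin N → Bool) (p : Fin N → Z × Z) (j : Fin N) : Z × Z :=
  if σ j then (p j).swap else p j

theorem measurePreserving_swapPairs [MeasurableSpace Z] (P : Measure Z) [IsProbabilityMeasure P]
    {N : ℕ} (σ : Fin N → Bool) :
    MeasurePreserving (swapPairs (Z := Z) σ) (Measure.pi fun _ => P.prod P)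
      (Measure.pi fun _ => P.prod P) := by
  refine measurePreserving_pi (fun _ : Fin N => P.prod P) (fun _ => P.prod P)
    (f := fun j z => if σ j then z.swap else z) fun j => ?_
  by_cases h : σ j
  · simpa [h] using Measure.measurePreserving_swap
  · simp only [h]
    exact MeasurePreserving.id (P.prod P)

variable {ι : Type*} {N : ℕ}

/-- The exponential weight of an ordered pair of samples. -/
noncomputable def pairWeight (D B : Set Z) (α c : ℝ) (p : Fin N → Z × Z) : ENNReal :=
  ∏ j, ENNReal.ofReal
    (Real.exp (slabWeight D B α c (4 * c ^ 2) (p j).1 - slabWeight D B α c 0 (p j).2))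

/-- The swaps are independent across pairs, so the sum over `σ` factors into a product of two-term
sums, each at most 2. -/
theorem sum_pairWeight_swapPairs_le {D B : Set Z} {α c : ℝ} (hα0 : 0 ≤ α) (hα1 : α ≤ 1)
    (hc0 : 0 ≤ c) (hc1 : c ≤ 1 / 2) (p : Fin N → Z × Z) :
    ∑ σ : Fin N → Bool, pairWeight D B α c (swapPairs σ p) ≤ 2 ^ N := by
  have h := Finset.prod_univ_sum (fun _ : Fin N => (Finset.univ : Finset Bool))
    (fun j b => ENNReal.ofReal (Real.exp
      (slabWeight D B α c (4 * c ^ 2) (if b then (p j).swap else p j).1 -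
        slabWeight D B α c 0 (if b then (p j).swap else p j).2)))
  rw [Fintype.piFinset_univ] at h
  calc _ = _ := h.symm
    _ ≤ ∏ _j : Fin N, 2 := by
      refine Finset.prod_le_prod' fun j _ => ?_
      rw [Fintype.sum_bool, ← ENNReal.ofReal_add (Real.exp_nonneg _) (Real.exp_nonneg _)]
      refine (ENNReal.ofReal_le_ofReal
        (exp_slabWeight_swap_le hα0 hα1 hc0 hc1 (p j).2 (p j).1)).trans ?_
      simp
    _ = 2 ^ N := by simp

/-- Swapping permutes the `2N` points without changing them, so one index per trace serves every `σ`
at once, and the supremum is bounded by a sum over traces. -/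
theorem sum_iSup_pairWeight_swapPairs_le {D : Set Z} {B : ι → Set Z} {α c : ℝ} (hα0 : 0 ≤ α)
    (hα1 : α ≤ 1) (hc0 : 0 ≤ c) (hc1 : c ≤ 1 / 2) {G : ℕ}
    (hG : ∀ x : Fin N ⊕ Fin N → Z, (Set.range fun i => {k | x k ∈ B i}).ncard ≤ G)
    (p : Fin N → Z × Z) :
    ∑ σ : Fin N → Bool, ⨆ i, pairWeight D (B i) α c (swapPairs σ p) ≤ G * 2 ^ N := by
  classical
  set tr : ι → Set (Fin N ⊕ Fin N) := fun i =>
    {k | Sum.elim (fun j => (p j).1) (fun j => (p j).2) k ∈ B i} with htr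
  have hmem : ∀ i i', tr i = tr i' → ∀ j, ((p j).1 ∈ B i ↔ (p j).1 ∈ B i') ∧
      ((p j).2 ∈ B i ↔ (p j).2 ∈ B i') := fun i i' h j =>
    ⟨Set.ext_iff.1 h (Sum.inl j), Set.ext_iff.1 h (Sum.inr j)⟩
  have hval : ∀ i i', tr i = tr i' → ∀ σ, pairWeight D (B i) α c (swapPairs σ p) =
      pairWeight D (B i') α c (swapPairs σ p) := by
    intro i i' h σ
    refine Finset.prod_congr rfl fun j _ => ?_
    obtain ⟨h1, h2⟩ := hmem i i' h j
    by_cases hσ : σ j <;> simp [swapPairs, slabWeight, hσ, h1, h2]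
  let rep : Set.range tr → ι := fun T => T.2.choose
  have hrep : ∀ i, tr (rep ⟨tr i, i, rfl⟩) = tr i := fun i =>
    (⟨tr i, i, rfl⟩ : Set.range tr).2.choose_spec
  calc _ ≤ ∑ σ : Fin N → Bool, ∑ T : Set.range tr,
          pairWeight D (B (rep T)) α c (swapPairs σ p) := by
        refine Finset.sum_le_sum fun σ _ => iSup_le fun i => ?_
        rw [hval _ _ (hrep i).symm σ]
        exact Finset.single_le_sum
          (f := fun T : Set.range tr => pairWeight D (B (rep T)) α c (swapPairs σ p))
          (fun _ _ => zero_le) (Finset.mem_univ _)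
    _ = ∑ T : Set.range tr, ∑ σ : Fin N → Bool,
          pairWeight D (B (rep T)) α c (swapPairs σ p) := Finset.sum_comm
    _ ≤ ∑ _T : Set.range tr, 2 ^ N :=
        Finset.sum_le_sum fun T _ => sum_pairWeight_swapPairs_le hα0 hα1 hc0 hc1 p
    _ = ((Set.range tr).ncard : ENNReal) * 2 ^ N := by
        rw [Finset.sum_const, nsmul_eq_mul, Finset.card_univ, ← Nat.card_eq_fintype_card]
        rfl
    _ ≤ G * 2 ^ N := by
        gcongr
        exact hG _

variable [MeasurableSpace Z]

theorem measurable_pairWeight {D B : Set Z} (hD : MeasurableSet D) (hB : MeasurableSet B)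
    (α c : ℝ) : Measurable (pairWeight (N := N) D B α c) := by
  have h1 := measurable_slabWeight hD hB α c (4 * c ^ 2)
  have h2 := measurable_slabWeight hD hB α c 0
  unfold pairWeight
  fun_prop

/-- Each swap preserves the law of the pairs, so the integral equals its average over all `2 ^ N`
swaps. -/
theorem lintegral_iSup_pairWeight_le [Countable ι] (P : Measure Z) [IsProbabilityMeasure P]
    {D : Set Z} {B : ι → Set Z} (hD : MeasurableSet D) (hB : ∀ i, MeasurableSet (B i)) {α c : ℝ}
    (hα0 : 0 ≤ α) (hα1 : α ≤ 1) (hc0 : 0 ≤ c) (hc1 : c ≤ 1 / 2) {G : ℕ}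
    (hG : ∀ x : Fin N ⊕ Fin N → Z, (Set.range fun i => {k | x k ∈ B i}).ncard ≤ G) :
    ∫⁻ p, ⨆ i, pairWeight (N := N) D (B i) α c p ∂(Measure.pi fun _ => P.prod P) ≤ G := by
  have hm : Measurable fun p : Fin N → Z × Z => ⨆ i, pairWeight D (B i) α c p :=
    Measurable.iSup fun i => measurable_pairWeight hD (hB i) α c
  have hsw := fun σ : Fin N → Bool => (measurePreserving_swapPairs P σ).lintegral_comp hm
  have h2 : (2 : ENNReal) ^ N * ∫⁻ p, ⨆ i, pairWeight (N := N) D (B i) α c p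
      ∂(Measure.pi fun _ => P.prod P) ≤ 2 ^ N * G := by
    calc _ = ∑ σ : Fin N → Bool, ∫⁻ p, ⨆ i, pairWeight (N := N) D (B i) α c (swapPairs σ p)
          ∂(Measure.pi fun _ => P.prod P) := by
          simp [hsw]
      _ = ∫⁻ p, ∑ σ : Fin N → Bool, ⨆ i, pairWeight (N := N) D (B i) α c (swapPairs σ p)
          ∂(Measure.pi fun _ => P.prod P) :=
          (lintegral_finsetSum _ fun σ _ =>
            hm.comp (measurePreserving_swapPairs P σ).measurable).symm
      _ ≤ ∫⁻ _p, G * 2 ^ N ∂(Measure.pi fun _ : Fin N => P.prod P) :=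
          lintegral_mono fun p => sum_iSup_pairWeight_swapPairs_le hα0 hα1 hc0 hc1 hG p
      _ = 2 ^ N * G := by simp [mul_comm]
  exact (ENNReal.mul_le_mul_iff_right (by simp) (by finiteness)).1 h2

/-- By convexity, the ghost sample has exponential weight at least one. -/
theorem one_le_lintegral_exp_neg_slabWeight (P : Measure Z) [IsProbabilityMeasure P]
    {D B : Set Z} (hD : MeasurableSet D) (hB : MeasurableSet B) {α c : ℝ} (hc0 : 0 ≤ c)
    (hcov : P.real (D ∩ B) ≤ α * P.real B) :
    1 ≤ ∫⁻ s : Fin N → Z, ENNReal.ofReal (Real.exp (-∑ j, slabWeight D B α c 0 (s j)))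
      ∂(Measure.pi fun _ => P) := by
  have hmeas := measurable_slabWeight hD hB α c 0
  have hint : ∀ j : Fin N, Integrable (fun s : Fin N → Z => slabWeight D B α c 0 (s j))
      (Measure.pi fun _ => P) := fun j =>
    integrable_comp_eval (μ := fun _ : Fin N => P) (integrable_slabWeight hD hB α c 0)
  have hsum : Integrable (fun s : Fin N → Z => ∑ j, slabWeight D B α c 0 (s j))
      (Measure.pi fun _ => P) := integrable_finsetSum _ fun j _ => hint j
  have hle : ∫ s : Fin N → Z, ∑ j, slabWeight D B α c 0 (s j) ∂(Measure.pi fun _ => P) ≤ 0 := by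
    rw [integral_finsetSum _ fun j _ => hint j]
    refine Finset.sum_nonpos fun j _ => ?_
    rw [integral_comp_eval (μ := fun _ : Fin N => P) hmeas.aestronglyMeasurable,
      integral_slabWeight hD hB]
    exact mul_nonpos_of_nonneg_of_nonpos hc0 (by linarith)
  have hexp : Integrable (fun s : Fin N → Z => Real.exp (-∑ j, slabWeight D B α c 0 (s j)))
      (Measure.pi fun _ => P) := by
    refine Integrable.of_bound (Measurable.aestronglyMeasurable (by fun_prop)) (Real.exp (∑ _j : Fin N, (|c| * (1 + |α|) + |(0:ℝ)|)))
      (Filter.Eventually.of_forall fun s => ?_)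
    rw [Real.norm_eq_abs, Real.abs_exp, ← Finset.sum_neg_distrib]
    exact Real.exp_le_exp.2 (Finset.sum_le_sum fun j _ =>
      (neg_le_abs _).trans (abs_slabWeight_le (s j)))
  rw [← ofReal_integral_eq_lintegral_ofReal hexp
    (Filter.Eventually.of_forall fun s => Real.exp_nonneg _)]
  rw [ENNReal.one_le_ofReal]
  -- Convexity enters as `1 - S ≤ exp (-S)`, where `S` has nonpositive mean.
  calc (1 : ℝ) ≤ ∫ s : Fin N → Z, (1 - ∑ j, slabWeight D B α c 0 (s j))
        ∂(Measure.pi fun _ => P) := by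
        rw [integral_sub (integrable_const _) hsum]
        simpa using hle
    _ ≤ _ := integral_mono ((integrable_const _).sub hsum) hexp fun s => by
        simpa [sub_eq_neg_add] using
          Real.add_one_le_exp (-∑ j, slabWeight D B α c 0 (s j))

/-- For each fixed index the ghost factor can be inserted, having mean at least 1; the supremum then
moves inside the ghost integral. -/
theorem lintegral_iSup_exp_slabWeight_le [Countable ι] (P : Measure Z) [IsProbabilityMeasure P]
    {D : Set Z} {B : ι → Set Z} (hD : MeasurableSet D) (hB : ∀ i, MeasurableSet (B i)) {α c : ℝ}
    (hα0 : 0 ≤ α) (hα1 : α ≤ 1) (hc0 : 0 ≤ c) (hc1 : c ≤ 1 / 2)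
    (hcov : ∀ i, P.real (D ∩ B i) ≤ α * P.real (B i)) {G : ℕ}
    (hG : ∀ x : Fin N ⊕ Fin N → Z, (Set.range fun i => {k | x k ∈ B i}).ncard ≤ G) :
    ∫⁻ s : Fin N → Z, ⨆ i, ENNReal.ofReal
      (Real.exp (∑ j, slabWeight D (B i) α c (4 * c ^ 2) (s j))) ∂(Measure.pi fun _ => P) ≤ G := by
  let e := MeasurableEquiv.arrowProdEquivProdArrow Z Z (Fin N)
  have he : MeasurePreserving e (Measure.pi fun _ => P.prod P)
      ((Measure.pi fun _ => P).prod (Measure.pi fun _ => P)) :=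
    measurePreserving_arrowProdEquivProdArrow Z Z (Fin N) (fun _ => P) (fun _ => P)
  let H : (Fin N → Z) × (Fin N → Z) → ENNReal := fun q =>
    ⨆ i, pairWeight D (B i) α c (e.symm q)
  have hH : Measurable H := (Measurable.iSup fun i => measurable_pairWeight hD (hB i) α c).comp
    e.symm.measurable
  have hHe : ∀ s s' i, ENNReal.ofReal
      (Real.exp (∑ j, slabWeight D (B i) α c (4 * c ^ 2) (s j))) *
      ENNReal.ofReal (Real.exp (-∑ j, slabWeight D (B i) α c 0 (s' j))) ≤ H (s, s') := by
    intro s s' i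
    refine le_trans (le_of_eq ?_) (le_iSup _ i)
    have h : pairWeight D (B i) α c (e.symm (s, s')) = ∏ j, ENNReal.ofReal (Real.exp
      (slabWeight D (B i) α c (4 * c ^ 2) (s j) - slabWeight D (B i) α c 0 (s' j))) := rfl
    rw [h, ← ENNReal.ofReal_prod_of_nonneg fun _ _ => Real.exp_nonneg _, ← Real.exp_sum,
      ← ENNReal.ofReal_mul (Real.exp_nonneg _), ← Real.exp_add, Finset.sum_sub_distrib,
      sub_eq_add_neg]
  calc _ ≤ ∫⁻ s, ∫⁻ s', H (s, s') ∂(Measure.pi fun _ => P) ∂(Measure.pi fun _ => P) := by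
        refine lintegral_mono fun s => iSup_le fun i => ?_
        have h1 := one_le_lintegral_exp_neg_slabWeight (N := N) P hD (hB i) hc0 (hcov i)
        refine (le_mul_of_one_le_right zero_le h1).trans ?_
        rw [← lintegral_const_mul' _ _ ENNReal.ofReal_ne_top]
        exact lintegral_mono fun s' => hHe s s' i
    _ = ∫⁻ q, H q ∂((Measure.pi fun _ => P).prod (Measure.pi fun _ => P)) :=
        (lintegral_prod _ hH.aemeasurable).symm
    _ = ∫⁻ p, H (e p) ∂(Measure.pi fun _ => P.prod P) := (he.lintegral_comp hH).symm
    _ = ∫⁻ p, ⨆ i, pairWeight (N := N) D (B i) α c p ∂(Measure.pi fun _ => P.prod P) := by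
        simp [H]
    _ ≤ G := lintegral_iSup_pairWeight_le P hD hB hα0 hα1 hc0 hc1 hG

/-- Uniform self-normalized deviation bound for a countable family of sets. -/
theorem measure_exists_sum_slabWeight_ge_le [Countable ι] (P : Measure Z) [IsProbabilityMeasure P]
    {D : Set Z} {B : ι → Set Z} (hD : MeasurableSet D) (hB : ∀ i, MeasurableSet (B i)) {α c : ℝ}
    (hα0 : 0 ≤ α) (hα1 : α ≤ 1) (hc0 : 0 ≤ c) (hc1 : c ≤ 1 / 2)
    (hcov : ∀ i, P.real (D ∩ B i) ≤ α * P.real (B i)) {G : ℕ} (hG0 : G ≠ 0)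
    (hG : ∀ x : Fin N ⊕ Fin N → Z, (Set.range fun i => {k | x k ∈ B i}).ncard ≤ G) (τ : ℝ) :
    (Measure.pi fun _ : Fin N => P)
      {s | ∃ i, Real.log G + τ ≤ ∑ j, slabWeight D (B i) α c (4 * c ^ 2) (s j)}
      ≤ ENNReal.ofReal (Real.exp (-τ)) := by
  have hGpos : (0 : ℝ) < G := by exact_mod_cast Nat.pos_of_ne_zero hG0
  have hm : Measurable fun s : Fin N → Z => ⨆ i, ENNReal.ofReal
      (Real.exp (∑ j, slabWeight D (B i) α c (4 * c ^ 2) (s j))) := by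
    refine Measurable.iSup fun i => ?_
    have := measurable_slabWeight hD (hB i) α c (4 * c ^ 2)
    fun_prop
  set ε : ENNReal := ENNReal.ofReal (G * Real.exp τ) with hε
  have hε0 : ε ≠ 0 := by
    rw [hε, Ne, ENNReal.ofReal_eq_zero, not_le]
    positivity
  calc _ ≤ (Measure.pi fun _ : Fin N => P) {s | ε ≤ ⨆ i, ENNReal.ofReal
          (Real.exp (∑ j, slabWeight D (B i) α c (4 * c ^ 2) (s j)))} := by
        refine measure_mono ?_
        rintro s ⟨i, hi⟩
        refine le_trans (ENNReal.ofReal_le_ofReal ?_) (le_iSup (fun i => ENNReal.ofReal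
          (Real.exp (∑ j, slabWeight D (B i) α c (4 * c ^ 2) (s j)))) i)
        calc _ = Real.exp (Real.log G + τ) := by rw [Real.exp_add, Real.exp_log hGpos]
          _ ≤ _ := Real.exp_le_exp.2 hi
    _ ≤ (∫⁻ s, ⨆ i, ENNReal.ofReal
          (Real.exp (∑ j, slabWeight D (B i) α c (4 * c ^ 2) (s j)))
          ∂(Measure.pi fun _ : Fin N => P)) / ε :=
        meas_ge_le_lintegral_div hm.aemeasurable hε0 ENNReal.ofReal_ne_top
    _ ≤ G / ε := by
        gcongr
        exact lintegral_iSup_exp_slabWeight_le P hD hB hα0 hα1 hc0 hc1 hcov hG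
    _ = ENNReal.ofReal (Real.exp (-τ)) := by
        rw [hε, ← ENNReal.ofReal_natCast, ← ENNReal.ofReal_div_of_pos (by positivity),
          Real.exp_neg]
        congr 1
        field_simp

end Symmetrization

/-! ### Reduction to countably many slabs. -/

theorem continuous_quadraticFn {d : ℕ} (W : Matrix (Fin d) (Fin d) ℝ) (v : Fin d → ℝ) :
    Continuous (quadraticFn W v) := by
  unfold quadraticFn Matrix.mulVec dotProduct
  fun_prop

theorem continuous_quadraticFn_param {d : ℕ} (x : Fin d → ℝ) :
    Continuous fun θ : Matrix (Fin d) (Fin d) ℝ × (Fin d → ℝ) => quadraticFn θ.1 θ.2 x := by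
  unfold quadraticFn Matrix.mulVec dotProduct
  fun_prop

theorem measurableSet_slabEvent {d : ℕ} {𝒴 : Type*} [MeasurableSpace 𝒴]
    (W : Matrix (Fin d) (Fin d) ℝ) (v : Fin d → ℝ) (a b : ℝ) :
    MeasurableSet (slabEvent (𝒴 := 𝒴) (quadraticFn W v) a b) := by
  have h : Measurable fun z : (Fin d → ℝ) × 𝒴 => quadraticFn W v z.1 :=
    (continuous_quadraticFn W v).measurable.comp measurable_fst
  exact (measurableSet_le measurable_const h).inter (measurableSet_le h measurable_const)

theorem exists_rat_lt_forall_lt {κ : Type*} [Finite κ] (f : κ → ℝ) (a : ℝ) :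
    ∃ r : ℚ, (r : ℝ) < a ∧ ∀ k, f k < a → f k < r := by
  have h : ∀ᶠ r in nhdsWithin a (Set.Iio a), ∀ k, f k < a → f k < r := by
    refine Filter.eventually_all.2 fun k => ?_
    by_cases hk : f k < a
    · filter_upwards [mem_nhdsWithin_of_mem_nhds (lt_mem_nhds hk)] with r hr _ using hr
    · exact Filter.Eventually.of_forall fun r h => absurd h hk
  obtain ⟨l, hl, hsub⟩ := mem_nhdsLT_iff_exists_Ioo_subset.1 h
  obtain ⟨r, hr1, hr2⟩ := exists_rat_btwn (Set.mem_Iio.1 hl)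
  exact ⟨r, hr2, hsub ⟨hr1, hr2⟩⟩

/-- The traces of the slabs on finite samples are realized by slabs with rational ends and with
parameters in a dense subset. -/
theorem exists_rat_slab_trace_eq {κ : Type*} [Finite κ] {d : ℕ} (x : κ → Fin d → ℝ)
    {Θ : Set (Matrix (Fin d) (Fin d) ℝ × (Fin d → ℝ))} {S : Set Θ} (hS : Dense S) (θ : Θ)
    {a b : ℝ} (hab : a < b) :
    ∃ θ' ∈ S, ∃ a' b' : ℚ, a' < b' ∧ ∀ k,
      ((a' : ℝ) ≤ quadraticFn θ'.1.1 θ'.1.2 (x k) ∧ quadraticFn θ'.1.1 θ'.1.2 (x k) ≤ b' ↔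
        a ≤ quadraticFn θ.1.1 θ.1.2 (x k) ∧ quadraticFn θ.1.1 θ.1.2 (x k) ≤ b) := by
  set f : Θ → κ → ℝ := fun θ k => quadraticFn θ.1.1 θ.1.2 (x k) with hf
  have hcont : ∀ k, Continuous fun θ => f θ k := fun k =>
    (continuous_quadraticFn_param (x k)).comp continuous_subtype_val
  obtain ⟨a', ha', hfa⟩ := exists_rat_lt_forall_lt (f θ) a
  obtain ⟨b'', hb'', hfb'⟩ := exists_rat_lt_forall_lt (fun k => -f θ k) (-b)
  obtain ⟨b', rfl⟩ : ∃ b', b'' = -b' := ⟨-b'', by simp⟩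
  have hb' : b < b' := by push_cast at hb''; linarith
  have hfb : ∀ k, b < f θ k → (b' : ℝ) < f θ k := fun k h => by
    have := hfb' k (by linarith)
    push_cast at this
    linarith
  -- With the widened rational ends every sample value is strictly inside or strictly outside;
  -- finitely many strict inequalities survive a small change of `θ`.
  have hev : ∀ᶠ θ' in nhds θ, ∀ k,
      ((a' : ℝ) ≤ f θ' k ∧ f θ' k ≤ b' ↔ a ≤ f θ k ∧ f θ k ≤ b) := by
    refine Filter.eventually_all.2 fun k => ?_
    have hk := (hcont k).tendsto θ
    rcases lt_or_ge (f θ k) a with h1 | h1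
    · filter_upwards [hk.eventually (gt_mem_nhds (hfa k h1))] with θ' h
      constructor <;> intro h' <;> linarith [h'.1]
    rcases lt_or_ge b (f θ k) with h2 | h2
    · filter_upwards [hk.eventually (lt_mem_nhds (hfb k h2))] with θ' h
      constructor <;> intro h' <;> linarith [h'.2]
    · filter_upwards [hk.eventually (lt_mem_nhds (ha'.trans_le h1)),
        hk.eventually (gt_mem_nhds (h2.trans_lt hb'))] with θ' h h'
      exact ⟨fun _ => ⟨h1, h2⟩, fun _ => ⟨h.le, h'.le⟩⟩
  obtain ⟨θ', hθ', hS'⟩ := hS.inter_nhds_nonempty hev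
  exact ⟨θ', hθ', a', b', by exact_mod_cast (ha'.trans hab).trans hb', hS'⟩

/-! ### Consequences of slab coverage. -/

/-- Clearing the denominator gives a form of coverage that also holds on null slabs, about which the
hypothesis is silent. -/
theorem HasSlabCoverage.real_compl_inter_le {d : ℕ} {𝒴 : Type*} [MeasurableSpace 𝒴]
    {P : Measure ((Fin d → ℝ) × 𝒴)} [IsProbabilityMeasure P] {C : (Fin d → ℝ) → Set 𝒴}
    (hC : MeasurableSet (coverEvent C)) {α : ℝ}
    {Θ : Set (Matrix (Fin d) (Fin d) ℝ × (Fin d → ℝ))} (h : HasSlabCoverage P C α Θ)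
    {θ : Matrix (Fin d) (Fin d) ℝ × (Fin d → ℝ)} (hθ : θ ∈ Θ) {a b : ℝ} (hab : a < b) :
    P.real ((coverEvent C)ᶜ ∩ slabEvent (quadraticFn θ.1 θ.2) a b) ≤
      α * P.real (slabEvent (quadraticFn θ.1 θ.2) a b) := by
  set B : Set ((Fin d → ℝ) × 𝒴) := slabEvent (quadraticFn θ.1 θ.2) a b with hB
  have hsplit := measureReal_inter_add_sdiff (μ := P) (s := B) hC
  rw [Set.sdiff_eq] at hsplit
  rw [Set.inter_comm]
  by_cases h0 : P B = 0
  · have h1 : P.real B = 0 := by simp [Measure.real, h0]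
    have h2 : 0 ≤ P.real (B ∩ coverEvent C) := measureReal_nonneg
    rw [h1] at hsplit ⊢
    linarith
  · have h1 := h θ hθ a b hab h0
    rw [cond_apply (measurableSet_slabEvent _ _ _ _)] at h1
    have h2 : 1 - α ≤ (P.real B)⁻¹ * P.real (B ∩ coverEvent C) := by
      have := (ENNReal.ofReal_le_iff_le_toReal
        (ENNReal.mul_ne_top (ENNReal.inv_ne_top.2 h0) (measure_ne_top _ _))).1 h1
      rwa [ENNReal.toReal_mul, ENNReal.toReal_inv] at this
    have hpos : 0 < P.real B := ENNReal.toReal_pos h0 (measure_ne_top _ _)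
    rw [inv_mul_eq_div, le_div_iff₀ hpos] at h2
    linarith

/-- Coverage on all slabs implies marginal coverage. -/
theorem HasSlabCoverage.measure_compl_le {d : ℕ} {𝒴 : Type*} [MeasurableSpace 𝒴]
    {P : Measure ((Fin d → ℝ) × 𝒴)} [IsProbabilityMeasure P] {C : (Fin d → ℝ) → Set 𝒴}
    (hC : MeasurableSet (coverEvent C)) {α : ℝ} (hα0 : 0 ≤ α)
    {Θ : Set (Matrix (Fin d) (Fin d) ℝ × (Fin d → ℝ))} (hΘ : Θ.Nonempty)
    (h : HasSlabCoverage P C α Θ) :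
    P (coverEvent C)ᶜ ≤ ENNReal.ofReal α := by
  obtain ⟨θ, hθ⟩ := hΘ
  set B : ℕ → Set ((Fin d → ℝ) × 𝒴) := fun n =>
    slabEvent (quadraticFn θ.1 θ.2) (-((n : ℝ) + 1)) ((n : ℝ) + 1) with hB
  have hmono : Monotone fun n => (coverEvent C)ᶜ ∩ B n := by
    intro m n hmn
    refine Set.inter_subset_inter_right _ fun z hz => ?_
    have : (m : ℝ) ≤ n := by exact_mod_cast hmn
    exact ⟨by linarith [hz.1], by linarith [hz.2]⟩
  have hUnion : ⋃ n, (coverEvent C)ᶜ ∩ B n = (coverEvent C)ᶜ := by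
    rw [← Set.inter_iUnion]
    refine Set.inter_eq_left.2 fun z _ => ?_
    obtain ⟨n, hn⟩ := exists_nat_ge |quadraticFn θ.1 θ.2 z.1|
    refine Set.mem_iUnion.2 ⟨n, ?_⟩
    have := abs_le.1 hn
    exact ⟨by linarith [this.1], by linarith [this.2]⟩
  have ht := tendsto_measure_iUnion_atTop (μ := P) hmono
  rw [hUnion] at ht
  refine le_of_tendsto' ht fun n => ?_
  have h1 := h.real_compl_inter_le hC hθ
    (show -((n : ℝ) + 1) < (n : ℝ) + 1 by have : (0 : ℝ) ≤ n := n.cast_nonneg; linarith)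
  rw [Function.comp_apply, ← ofReal_measureReal (μ := P) (s := (coverEvent C)ᶜ ∩ B n)]
  refine ENNReal.ofReal_le_ofReal (h1.trans ?_)
  exact mul_le_of_le_one_right hα0 measureReal_le_one

/-! ### Empirical probabilities and the infimum. -/

section Empirical

variable {N : ℕ} {Z : Type*}

theorem empProb_nonneg (s : Fin N → Z) (A : Set Z) : 0 ≤ empProb s A := by
  unfold empProb
  positivity

theorem empCondProb_nonneg (s : Fin N → Z) (A B : Set Z) : 0 ≤ empCondProb s A B :=
  div_nonneg (empProb_nonneg s _) (empProb_nonneg s _)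

open Classical in
theorem sum_ite_mem_eq_empProb (hN : N ≠ 0) (s : Fin N → Z) (A : Set Z) :
    ∑ j, (if s j ∈ A then (1 : ℝ) else 0) = N * empProb s A := by
  have h : (N : ℝ) ≠ 0 := by exact_mod_cast hN
  rw [empProb, mul_div_cancel₀ _ h, Set.ncard_eq_toFinset_card']
  simp

theorem sum_slabWeight_compl (hN : N ≠ 0) (s : Fin N → Z) (A B : Set Z) (α c q : ℝ) :
    ∑ j, slabWeight Aᶜ B α c q (s j) =
      N * ((c * (1 - α) - q) * empProb s B - c * empProb s (A ∩ B)) := by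
  classical
  rw [mul_sub, mul_left_comm, mul_left_comm (N : ℝ) c, ← sum_ite_mem_eq_empProb hN,
    ← sum_ite_mem_eq_empProb hN, Finset.mul_sum, Finset.mul_sum, ← Finset.sum_sub_distrib]
  refine Finset.sum_congr rfl fun j _ => ?_
  by_cases hB : s j ∈ B <;> by_cases hA : s j ∈ A <;> (simp [slabWeight, hA, hB]; try ring)

theorem le_wscPlusInf (hN : N ≠ 0) {d : ℕ} {𝒴 : Type*} {C : (Fin d → ℝ) → Set 𝒴} {δ : ℝ}
    (hδ : δ ≤ 1) {s : Fin N → (Fin d → ℝ) × 𝒴}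
    {Θ : Set (Matrix (Fin d) (Fin d) ℝ × (Fin d → ℝ))} (hΘ : Θ.Nonempty) {r : ℝ}
    (h : ∀ θ : Θ, ∀ a b : ℝ, a < b → δ ≤ empProb s (slabEvent (quadraticFn θ.1.1 θ.1.2) a b) →
      r ≤ empCondProb s (coverEvent C) (slabEvent (quadraticFn θ.1.1 θ.1.2) a b)) :
    r ≤ wscPlusInf C δ s Θ := by
  have := hΘ.to_subtype
  -- Since `sInf ∅ = 0` in `ℝ`, an admissible slab must be exhibited: one wide enough to hold the
  -- whole sample has empirical mass `1 ≥ δ`.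
  refine le_ciInf fun θ => le_csInf ?_ ?_
  · set f : Fin N → ℝ := fun j => quadraticFn θ.1.1 θ.1.2 (s j).1
    obtain ⟨M, hM⟩ : ∃ M : ℝ, ∀ j, |f j| ≤ M := by
      obtain ⟨M, hM⟩ := (Set.finite_range fun j => |f j|).bddAbove
      exact ⟨M, fun j => hM ⟨j, rfl⟩⟩
    refine ⟨_, -(|M| + 1), |M| + 1, by linarith [abs_nonneg M], ?_, rfl⟩
    have hall : ∀ j, s j ∈ slabEvent (quadraticFn θ.1.1 θ.1.2) (-(|M| + 1)) (|M| + 1) := by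
      intro j
      have h1 := abs_le.1 ((hM j).trans (le_abs_self M))
      exact ⟨by linarith [h1.1], by linarith [h1.2]⟩
    have h0 : (N : ℝ) ≠ 0 := by exact_mod_cast hN
    simp only [empProb, hall, Set.ofPred_true, Set.ncard_univ, Nat.card_fin, div_self h0, hδ]
  · rintro _ ⟨a, b, hab, hd, rfl⟩
    exact h θ a b hab hd

end Empirical

/-! ### Choice of constants and conclusion. -/

theorem log_slab_growth_le {d N : ℕ} (hd : 1 ≤ d) (hN : 2 ≤ N) :
    Real.log (((Fintype.card (Fin N ⊕ Fin N) + 1) ^ (2 * (d ^ 2 + d + 1)) : ℕ) : ℝ) ≤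
      18 * ((d : ℝ) ^ 2 * Real.log N) := by
  have hd' : (1 : ℝ) ≤ d := by exact_mod_cast hd
  have hN' : (2 : ℝ) ≤ N := by exact_mod_cast hN
  have hlog : 0 ≤ Real.log N := Real.log_nonneg (by linarith)
  -- `2N + 1 ≤ N³` needs `N ≥ 2`; with `2 (d² + d + 1) ≤ 6d²` it yields `18 = 6 · 3`.
  have hbase : Real.log ((N : ℝ) + N + 1) ≤ 3 * Real.log N := by
    have h1 : Real.log ((N : ℝ) ^ 3) = 3 * Real.log N := by simp [Real.log_pow]
    rw [← h1]
    exact Real.log_le_log (by linarith) 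
      (by nlinarith [mul_nonneg (sub_nonneg.2 hN') (sub_nonneg.2 hN')])
  have hexp : (2 * ((d : ℝ) ^ 2 + d + 1)) ≤ 6 * (d : ℝ) ^ 2 := by nlinarith
  rw [Fintype.card_sum, Fintype.card_fin]
  push_cast
  rw [Real.log_pow]
  push_cast
  calc _ ≤ (2 * ((d : ℝ) ^ 2 + d + 1)) * (3 * Real.log N) := by gcongr
    _ ≤ 6 * (d : ℝ) ^ 2 * (3 * Real.log N) := by gcongr
    _ = _ := by ring

theorem measure_not_le_wscPlusInf_le_of_two_le {d N : ℕ} (hd : 1 ≤ d) (hN : 2 ≤ N)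
    {𝒴 : Type*} [MeasurableSpace 𝒴] (P : Measure ((Fin d → ℝ) × 𝒴)) [IsProbabilityMeasure P]
    {C : (Fin d → ℝ) → Set 𝒴} (hC : MeasurableSet (coverEvent C))
    {Θ : Set (Matrix (Fin d) (Fin d) ℝ × (Fin d → ℝ))} (hΘ : Θ.Nonempty)
    {α δ τ : ℝ} (hα0 : 0 < α) (hα1 : α < 1) (hδ0 : 0 < δ) (hδ1 : δ ≤ 1) (hτ : 0 < τ)
    (hcov : HasSlabCoverage P C α Θ)
    (hq : Real.sqrt (((d : ℝ) ^ 2 * Real.log N + τ) / (δ * N)) ≤ 1 / 2) :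
    (Measure.pi (fun _ : Fin N => P))
      {s | ¬ (1 - α - 22 * Real.sqrt (((d : ℝ) ^ 2 * Real.log N + τ) / (δ * N))
        ≤ wscPlusInf C δ s Θ)} ≤ ENNReal.ofReal (Real.exp (-τ)) := by
  have hN0 : N ≠ 0 := by omega
  have hNpos : (0 : ℝ) < N := by exact_mod_cast Nat.pos_of_ne_zero hN0
  have hL : 0 < (d : ℝ) ^ 2 * Real.log N + τ := by
    have : 0 ≤ Real.log N := Real.log_natCast_nonneg N
    positivity
  set c := Real.sqrt (((d : ℝ) ^ 2 * Real.log N + τ) / (δ * N)) with hc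
  have hc0 : 0 < c := Real.sqrt_pos.2 (by positivity)
  have hcsq : c ^ 2 * (δ * N) = (d : ℝ) ^ 2 * Real.log N + τ := by
    rw [hc, Real.sq_sqrt (by positivity), div_mul_cancel₀ _ (by positivity)]
  have : SecondCountableTopology (Matrix (Fin d) (Fin d) ℝ) :=
    inferInstanceAs (SecondCountableTopology (Fin d → Fin d → ℝ))
  obtain ⟨S, hSc, hSd⟩ := TopologicalSpace.exists_countable_dense Θ
  have := hSc.to_subtype
  let ι := S × {r : ℚ × ℚ // r.1 < r.2}
  let B : ι → Set ((Fin d → ℝ) × 𝒴) := fun i =>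
    slabEvent (quadraticFn i.1.1.1.1 i.1.1.1.2) (i.2.1.1 : ℝ) (i.2.1.2 : ℝ)
  set G : ℕ := (Fintype.card (Fin N ⊕ Fin N) + 1) ^ (2 * (d ^ 2 + d + 1)) with hG
  have hdev := measure_exists_sum_slabWeight_ge_le (N := N) P (D := (coverEvent C)ᶜ) (B := B)
    hC.compl (fun i => measurableSet_slabEvent _ _ _ _) hα0.le hα1.le hc0.le hq
    (fun i => hcov.real_compl_inter_le hC i.1.1.2 (by exact_mod_cast i.2.2))
    (G := G) (by positivity)
    (fun x => ncard_slab_traces_le (fun k => (x k).1) (fun i : ι => i.1.1.1)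
      (fun i => (i.2.1.1 : ℝ)) (fun i => (i.2.1.2 : ℝ))) τ
  refine (measure_mono fun s hs => ?_).trans hdev
  by_contra hno
  refine hs (le_wscPlusInf hN0 hδ1 hΘ fun θ a b hab hδs => ?_)
  by_contra hlt
  refine hno ?_
  obtain ⟨θ', hθ', a', b', hab', htr⟩ := exists_rat_slab_trace_eq (fun j => (s j).1) hSd θ hab
  refine ⟨(⟨θ', hθ'⟩, ⟨(a', b'), hab'⟩), ?_⟩
  set B₀ : Set ((Fin d → ℝ) × 𝒴) := slabEvent (quadraticFn θ.1.1 θ.1.2) a b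
  have hw : ∀ j, slabWeight (coverEvent C)ᶜ (B (⟨θ', hθ'⟩, ⟨(a', b'), hab'⟩)) α c (4 * c ^ 2) (s j)
      = slabWeight (coverEvent C)ᶜ B₀ α c (4 * c ^ 2) (s j) := by
    intro j
    have hj : s j ∈ B (⟨θ', hθ'⟩, ⟨(a', b'), hab'⟩) ↔ s j ∈ B₀ := htr j
    by_cases h : s j ∈ B₀
    · rw [slabWeight, slabWeight, if_pos h, if_pos (hj.2 h)]
    · rw [slabWeight, slabWeight, if_neg h, if_neg (mt hj.1 h)]
  simp_rw [hw]
  rw [sum_slabWeight_compl hN0]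
  have hB0 : 0 < empProb s B₀ := hδ0.trans_le hδs
  rw [not_le, empCondProb, div_lt_iff₀ hB0] at hlt
  have hgrow := log_slab_growth_le hd hN
  -- A shortfall of `22c` makes the penalized sum at least `(22 - 4) c² N ℙₙ(B₀) ≥ 18 c² δ N = 18
  -- (d² log N + τ)`, which is at least `log G + τ`; hence `K = 22 = 18 + 4`.
  have h1 : c * empProb s (coverEvent C ∩ B₀) ≤ c * ((1 - α - 22 * c) * empProb s B₀) :=
    mul_le_mul_of_nonneg_left hlt.le hc0.le
  have h2 : c ^ 2 * (δ * N) ≤ c ^ 2 * (empProb s B₀ * N) := by gcongr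
  have h3 := mul_le_mul_of_nonneg_left h1 hNpos.le
  rw [← hG] at hgrow
  nlinarith

/-- If the single observation is covered, every admissible slab has empirical conditional coverage
1, so failure forces a miscovered point. -/
theorem measure_not_le_wscPlusInf_le_of_single {d : ℕ}
    {𝒴 : Type*} [MeasurableSpace 𝒴] (P : Measure ((Fin d → ℝ) × 𝒴)) [IsProbabilityMeasure P]
    {C : (Fin d → ℝ) → Set 𝒴} (hC : MeasurableSet (coverEvent C))
    {Θ : Set (Matrix (Fin d) (Fin d) ℝ × (Fin d → ℝ))} (hΘ : Θ.Nonempty)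
    {α δ r : ℝ} (hα0 : 0 ≤ α) (hδ0 : 0 < δ) (hδ1 : δ ≤ 1) (hr : r ≤ 1)
    (hcov : HasSlabCoverage P C α Θ) :
    (Measure.pi (fun _ : Fin 1 => P)) {s | ¬ (r ≤ wscPlusInf C δ s Θ)} ≤ ENNReal.ofReal α := by
  calc _ ≤ (Measure.pi (fun _ : Fin 1 => P)) (Function.eval 0 ⁻¹' (coverEvent C)ᶜ) := by
        refine measure_mono fun s hs hmem => hs ?_
        refine le_wscPlusInf one_ne_zero hδ1 hΘ fun θ a b hab hδs => ?_
        have hall : ∀ j, s j ∈ coverEvent C := fun j => by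
          rw [Subsingleton.elim j 0]
          exact hmem
        refine hr.trans_eq ?_
        have heq : empProb s (coverEvent C ∩ slabEvent (quadraticFn θ.1.1 θ.1.2) a b) =
            empProb s (slabEvent (quadraticFn θ.1.1 θ.1.2) a b) := by
          simp [empProb, Set.mem_inter_iff, hall]
        rw [empCondProb, heq, div_self (hδ0.trans_le hδs).ne']
    _ = P (coverEvent C)ᶜ :=
        (measurePreserving_eval (fun _ : Fin 1 => P) 0).measure_preimage
          hC.compl.nullMeasurableSet
    _ ≤ _ := hcov.measure_compl_le hC hα0 hΘ

theorem proposition2 :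
    ∃ K : ℝ, 0 < K ∧
      ∀ (d N : ℕ) (_ : 1 ≤ d) (_ : 1 ≤ N)
        (𝒴 : Type u) [MeasurableSpace 𝒴]
        (P : Measure ((Fin d → ℝ) × 𝒴)) [IsProbabilityMeasure P]
        (C : (Fin d → ℝ) → Set 𝒴) (_ : MeasurableSet (coverEvent C))
        (Θ : Set (Matrix (Fin d) (Fin d) ℝ × (Fin d → ℝ))) (_ : Θ.Nonempty)
        (α δ τ : ℝ) (_ : 0 < α) (_ : α < 1) (_ : 0 < δ) (_ : δ ≤ 1) (_ : 0 < τ)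
        (_ : HasSlabCoverage P C α Θ),
        (Measure.pi (fun _ : Fin N => P))
            {s | ¬ (1 - α - K * Real.sqrt (((d : ℝ) ^ 2 * Real.log N + τ) / (δ * N))
                  ≤ wscPlusInf C δ s Θ)}
          ≤ ENNReal.ofReal (Real.exp (-τ)) := by
  refine ⟨22, by norm_num, ?_⟩
  intro d N hd hN 𝒴 _ P _ C hC Θ hΘ α δ τ hα0 hα1 hδ0 hδ1 hτ hcov
  -- The infimum is nonnegative, so a nonpositive bound never fails. Otherwise the square root is
  -- below `1/22`, which supplies `c ≤ 1/2`.
  by_cases htriv : 1 - α - 22 * Real.sqrt (((d : ℝ) ^ 2 * Real.log N + τ) / (δ * N)) ≤ 0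
  · refine (le_of_eq ?_).trans zero_le
    convert! measure_empty (μ := Measure.pi fun _ : Fin N => P)
    refine Set.eq_empty_of_forall_notMem fun s hs => hs ?_
    exact le_wscPlusInf (by omega) hδ1 hΘ fun θ a b _ _ =>
      htriv.trans (empCondProb_nonneg _ _ _)
  rcases hN.eq_or_lt with rfl | hN2
  · refine (measure_not_le_wscPlusInf_le_of_single P hC hΘ hα0.le hδ0 hδ1 ?_ hcov).trans
      (ENNReal.ofReal_le_ofReal ?_)
    · have := Real.sqrt_nonneg (((d : ℝ) ^ 2 * Real.log (1 : ℕ) + τ) / (δ * (1 : ℕ)))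
      linarith
    -- Here `α < 1 - 22√(τ/δ) ≤ 1 - 22√τ`; since `√τ < 1` this is at most `1 - τ ≤ exp (-τ)`.
    · simp only [Nat.cast_one, Real.log_one, mul_zero, zero_add, mul_one, not_le] at htriv
      have h1 : Real.sqrt τ ≤ Real.sqrt (τ / δ) :=
        Real.sqrt_le_sqrt (le_div_self hτ.le hδ0 hδ1)
      have h2 : Real.sqrt τ ^ 2 = τ := Real.sq_sqrt hτ.le
      have h3 := Real.sqrt_nonneg τ
      have h4 := Real.add_one_le_exp (-τ)
      nlinarith
  · refine measure_not_le_wscPlusInf_le_of_two_le hd hN2 P hC hΘ hα0 hα1 hδ0 hδ1 hτ hcov ?_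
    rw [not_le] at htriv
    linarith
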